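/- There are finite constants $C_p$ ($1<p<\infty$), depending only on $p$, such that the following holds. Let $(X,\mathcal B,\mu)$ be a non-atomic probability space and let $T:X\to X$ be an ergodic measure-preserving transformation. Then for all $1<p<\infty$, all nonnegative measurable functions $f,g:X\to\mathbb R$ and all $\lambda>0$, $$\mu\Big\{x:\ \sup_{n\ge 1}\frac{f(T^nx)\,g(T^{2n}x)}{n}>\lambda\Big\}\ \le\ C_p\Big(\frac{\|f\|_p\,\|g\|_1}{\lambda}\Big)^{1/2},$$ where the supremum and the norms $\|f\|_p=\big(\int f^p\,d\mu\big)^{1/p}$, $\|g\|_1=\int g\,d\mu$ take values in $[0,\infty]$ (with $0\cdot\infty=0$). Moreover, there is a finite constant $\widetilde C$ such that $C_p\le \widetilde C/(p-1)$ for all $1<p<2$. -/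

import Mathlib

open MeasureTheory
open scoped NNReal ENNReal

universe u

/-- A measure is non-atomic if every measurable set of positive measure has a measurable subset
of strictly smaller positive measure. (Mathlib's `NoAtoms` only says that points are null.) -/
def IsNonatomic {X : Type u} [MeasurableSpace X] (μ : Measure X) : Prop :=
  ∀ s : Set X, MeasurableSet s → 0 < μ s →
    ∃ t : Set X, t ⊆ s ∧ MeasurableSet t ∧ 0 < μ t ∧ μ t < μ s

/-- The tail maximal function `R*(f, g)(x) = sup_{n ≥ 1} f(T^n x) g(T^{2n} x) / n`.
The supremum is taken in the extended reals, so that it is `+∞` where it is unbounded. -/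
noncomputable def tailMaximal {X : Type u} (T : X → X) (f g : X → ℝ) (x : X) : EReal :=
  ⨆ (n : ℕ) (_ : 1 ≤ n), ((f (T^[n] x) * g (T^[2 * n] x) / (n : ℝ) : ℝ) : EReal)

/-! Normalise `‖F‖_p ≤ 1` and `λ = 1`. By the maximal ergodic theorem, forward averages of `F ^ p`
exceed `κ` only on a set of measure at most `1/κ`. For the other points, take a dyadic block `N ≤ n
< 2N` and sort the events by their endpoint `T^[2 * n] x`. If `G = γ` there, each admissible `n`
forces `F > N/γ` at a distinct place on one orbit segment of length at most `4N`, so Chebyshev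
against the average bound limits their number to `N min(1, (4κγ/N)^p)` (`card_goodTailSet_le`).
Transference along orbits turns this into a measure bound, and summing over dyadic `N` gives `O(κ
‖G‖₁ / (p - 1))`. Balancing with `1/κ` by `κ = ‖G‖₁^(-1/2)` yields the square root. -/

/-- The maximum `max_{0 ≤ k ≤ n} ∑_{j < k} ψ (T^j x)` of the Birkhoff sums, defined recursively. -/
noncomputable def maxBirkhoffSum {X : Type*} (T : X → X) (ψ : X → ℝ) : ℕ → X → ℝ
  | 0 => fun _ => 0
  | n + 1 => fun x => max 0 (ψ x + maxBirkhoffSum T ψ n (T x))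

/-! ### Maximal ergodic theorem and the weak type (1,1) bound -/

section MaximalErgodic

variable {X : Type*} {T : X → X} {ψ : X → ℝ}

lemma maxBirkhoffSum_nonneg (n : ℕ) (x : X) : 0 ≤ maxBirkhoffSum T ψ n x := by
  cases n with
  | zero => exact le_rfl
  | succ n => exact le_max_left _ _

lemma maxBirkhoffSum_le_succ (n : ℕ) (x : X) :
    maxBirkhoffSum T ψ n x ≤ maxBirkhoffSum T ψ (n + 1) x := by
  induction n generalizing x with
  | zero => exact maxBirkhoffSum_nonneg _ _
  | succ n ih => exact max_le_max le_rfl (add_le_add le_rfl (ih (T x)))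

lemma monotone_maxBirkhoffSum (x : X) : Monotone fun n => maxBirkhoffSum T ψ n x :=
  monotone_nat_of_le_succ fun n => maxBirkhoffSum_le_succ n x

lemma birkhoffSum_le_maxBirkhoffSum (n : ℕ) (x : X) :
    birkhoffSum T ψ n x ≤ maxBirkhoffSum T ψ n x := by
  induction n generalizing x with
  | zero => simp [maxBirkhoffSum]
  | succ n ih =>
    rw [birkhoffSum_succ']
    exact (add_le_add le_rfl (ih (T x))).trans (le_max_right _ _)

/-- Where the maximum is positive it is not attained by the empty sum, so it equals `ψ` plus a
shorter maximum at `T x`; elsewhere it vanishes. -/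
lemma maxBirkhoffSum_sub_comp_le_indicator (n : ℕ) (x : X) :
    maxBirkhoffSum T ψ n x - maxBirkhoffSum T ψ n (T x) ≤
      {y | 0 < maxBirkhoffSum T ψ n y}.indicator ψ x := by
  by_cases hx : 0 < maxBirkhoffSum T ψ n x
  · rw [Set.indicator_of_mem (by exact hx)]
    cases n with
    | zero => exact absurd hx (lt_irrefl _)
    | succ n =>
      have h1 : maxBirkhoffSum T ψ (n + 1) x = ψ x + maxBirkhoffSum T ψ n (T x) := by
        rcases max_choice 0 (ψ x + maxBirkhoffSum T ψ n (T x)) with h | h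
        · exact absurd (hx.trans_eq h) (lt_irrefl _)
        · exact h
      linarith [maxBirkhoffSum_le_succ (T := T) (ψ := ψ) n (T x)]
  · rw [Set.indicator_of_notMem (by exact hx)]
    linarith [maxBirkhoffSum_nonneg (T := T) (ψ := ψ) n (T x), not_lt.1 hx]

variable [MeasurableSpace X] {μ : Measure X}

lemma measurable_maxBirkhoffSum (hT : Measurable T) (hψ : Measurable ψ) (n : ℕ) :
    Measurable (maxBirkhoffSum T ψ n) := by
  induction n with
  | zero => exact measurable_const
  | succ n ih => exact measurable_const.max (hψ.add (ih.comp hT))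

lemma integrable_maxBirkhoffSum (hT : MeasurePreserving T μ μ) (hψ : Integrable ψ μ) (n : ℕ) :
    Integrable (maxBirkhoffSum T ψ n) μ := by
  induction n with
  | zero => exact integrable_zero _ _ _
  | succ n ih =>
    exact (integrable_zero _ _ _).sup (hψ.add (hT.integrable_comp_of_integrable ih))

/-- The **maximal ergodic theorem**. -/
theorem setIntegral_maxBirkhoffSum_pos_nonneg (hT : MeasurePreserving T μ μ)
    (hψm : Measurable ψ) (hψ : Integrable ψ μ) (n : ℕ) :
    0 ≤ ∫ x in {y | 0 < maxBirkhoffSum T ψ n y}, ψ x ∂μ := by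
  have hs : MeasurableSet {y | 0 < maxBirkhoffSum T ψ n y} :=
    measurableSet_lt measurable_const (measurable_maxBirkhoffSum hT.measurable hψm n)
  have hM := integrable_maxBirkhoffSum hT hψ n
  have hMT : Integrable (fun x => maxBirkhoffSum T ψ n (T x)) μ :=
    hT.integrable_comp_of_integrable hM
  have h0 : ∫ x, maxBirkhoffSum T ψ n (T x) ∂μ = ∫ x, maxBirkhoffSum T ψ n x ∂μ := by
    have := integral_map (μ := μ) hT.aemeasurable (f := maxBirkhoffSum T ψ n)
      (measurable_maxBirkhoffSum hT.measurable hψm n).aestronglyMeasurable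
    rw [hT.map_eq] at this
    exact this.symm
  rw [← integral_indicator hs]
  -- The coboundary integrates to zero by invariance of `μ`.
  calc (0 : ℝ) = ∫ x, (maxBirkhoffSum T ψ n x - maxBirkhoffSum T ψ n (T x)) ∂μ := by
        rw [integral_sub hM hMT, h0, sub_self]
    _ ≤ _ := integral_mono (hM.sub hMT) (hψ.indicator hs)
        fun x => maxBirkhoffSum_sub_comp_le_indicator n x

/-- The weak type `(1,1)` maximal inequality for ergodic averages. -/
theorem mul_measure_lt_birkhoffSum_le [IsFiniteMeasure μ] (hT : MeasurePreserving T μ μ)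
    {h : X → ℝ≥0} (hm : Measurable h) (hfin : ∫⁻ x, h x ∂μ ≠ ∞) (κ : ℝ) :
    ENNReal.ofReal κ * μ {x | ∃ n : ℕ, κ * n < birkhoffSum T (fun y => (h y : ℝ)) n x} ≤
      ∫⁻ x, h x ∂μ := by
  set ψ : X → ℝ := fun x => h x - κ with hψdef
  have hmr : Measurable fun x => (h x : ℝ) := hm.coe_nnreal_real
  have hint : Integrable (fun x => (h x : ℝ)) μ := by
    refine ⟨hmr.aestronglyMeasurable, ?_⟩
    simpa [HasFiniteIntegral, ← ENNReal.ofReal_coe_nnreal, enorm_eq_nnnorm] using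
      lt_top_iff_ne_top.2 hfin
  have hψm : Measurable ψ := hmr.sub_const _
  have hψ : Integrable ψ μ := hint.sub (integrable_const _)
  have hsum (n : ℕ) (x : X) :
      birkhoffSum T ψ n x = birkhoffSum T (fun y => (h y : ℝ)) n x - κ * n := by
    simp [birkhoffSum, hψdef, mul_comm]
  have hsub : {x | ∃ n : ℕ, κ * n < birkhoffSum T (fun y => (h y : ℝ)) n x} ⊆
      ⋃ n, {x | 0 < maxBirkhoffSum T ψ n x} := by
    rintro x ⟨n, hn⟩
    refine Set.mem_iUnion.2 ⟨n, lt_of_lt_of_le ?_ (birkhoffSum_le_maxBirkhoffSum n x)⟩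
    rw [hsum]
    linarith
  have hmono : Monotone fun n => {x | 0 < maxBirkhoffSum T ψ n x} :=
    fun a b hab x hx => lt_of_lt_of_le (by exact hx) (monotone_maxBirkhoffSum x hab)
  refine (mul_le_mul_right (measure_mono hsub) _).trans ?_
  rw [hmono.measure_iUnion, ENNReal.mul_iSup]
  refine iSup_le fun n => ?_
  set A := {x | 0 < maxBirkhoffSum T ψ n x} with hA
  have key := setIntegral_maxBirkhoffSum_pos_nonneg hT hψm hψ n
  rw [integral_sub hint.integrableOn (integrable_const _), setIntegral_const, smul_eq_mul,
    sub_nonneg] at key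
  calc ENNReal.ofReal κ * μ A = ENNReal.ofReal (μ.real A * κ) := by
        rw [mul_comm, ENNReal.ofReal_mul measureReal_nonneg, ofReal_measureReal]
    _ ≤ ENNReal.ofReal (∫ x in A, (h x : ℝ) ∂μ) := ENNReal.ofReal_le_ofReal key
    _ = ∫⁻ x in A, h x ∂μ := by
        rw [ofReal_integral_eq_lintegral_ofReal hint.integrableOn
          (Filter.Eventually.of_forall fun x => (h x).2)]
        simp
    _ ≤ ∫⁻ x, h x ∂μ := setLIntegral_le_lintegral _ _

end MaximalErgodic

/-! ### Dyadic summation -/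

/-- The dyadic sum `∑ₛ 2ˢ min(1, (a / 2ˢ)ᵖ)` is `O(a / (p - 1))` as `p` decreases to `1`. -/
lemma tsum_two_pow_mul_min_one_rpow_le {p : ℝ} (hp : 1 < p) (hp2 : p ≤ 3 / 2) {a : ℝ}
    (ha : 0 ≤ a) :
    ∑' s : ℕ, ENNReal.ofReal (2 ^ s * min 1 ((a / 2 ^ s) ^ p)) ≤
      ENNReal.ofReal (3 / (p - 1) * a) := by
  have hp1 : 0 < p - 1 := sub_pos.2 hp
  set r : ℝ := (1 / 2) ^ (p - 1) with hr
  have hr0 : 0 < r := by positivity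
  -- Bernoulli's inequality for an exponent at most 1; the geometric series of ratio `r` then costs
  -- `2 / (p - 1)`.
  have hr1 : r ≤ 1 - (p - 1) / 2 := by
    have := rpow_one_add_le_one_add_mul_self (s := -1 / 2) (by norm_num) hp1.le (by linarith)
    rw [hr]
    calc ((1 : ℝ) / 2) ^ (p - 1) = (1 + -1 / 2) ^ (p - 1) := by norm_num
      _ ≤ _ := this
      _ = _ := by ring
  have hex : ∃ s : ℕ, a < 2 ^ s := pow_unbounded_of_one_lt a (by norm_num)
  classical
  -- Splitting index: below `m` the bound 1 is used, from `m` on the power.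
  set m := Nat.find hex
  have hm : a < 2 ^ m := Nat.find_spec hex
  rw [← ENNReal.summable.sum_add_tsum_nat_add' (k := m)]
  have h1 : ∑ s ∈ Finset.range m, ENNReal.ofReal (2 ^ s * min 1 ((a / 2 ^ s) ^ p)) ≤
      ENNReal.ofReal (2 * a) := by
    calc _ ≤ ∑ s ∈ Finset.range m, ENNReal.ofReal (2 ^ s) :=
          Finset.sum_le_sum fun s _ => ENNReal.ofReal_le_ofReal <|
            mul_le_of_le_one_right (by positivity) (min_le_left _ _)
      _ = ENNReal.ofReal (∑ s ∈ Finset.range m, 2 ^ s) :=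
          (ENNReal.ofReal_sum_of_nonneg fun _ _ => by positivity).symm
      _ ≤ _ := by
          refine ENNReal.ofReal_le_ofReal ?_
          rw [geom_sum_eq (by norm_num)]
          rcases Nat.eq_zero_or_pos m with h | h
          · rw [h]; norm_num; exact ha
          · have h2 : (2 : ℝ) ^ (m - 1) ≤ a := not_lt.1 (Nat.find_min hex (Nat.sub_lt h one_pos))
            have h3 : (2 : ℝ) ^ m = 2 ^ (m - 1) * 2 := by rw [← pow_succ, Nat.sub_add_cancel h]
            rw [h3]
            linarith
  have h2 : ∑' s : ℕ, ENNReal.ofReal (2 ^ (s + m) * min 1 ((a / 2 ^ (s + m)) ^ p)) ≤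
      ENNReal.ofReal (2 / (p - 1) * a) := by
    calc _ ≤ ∑' s : ℕ, ENNReal.ofReal (a * r ^ s) := by
          refine ENNReal.tsum_le_tsum fun s => ENNReal.ofReal_le_ofReal ?_
          have hN : (0 : ℝ) < 2 ^ (s + m) := by positivity
          have hq : 0 ≤ a / 2 ^ (s + m) := by positivity
          have hq1 : a / 2 ^ (s + m) ≤ (1 / 2) ^ s := by
            rw [div_le_iff₀ hN, pow_add, one_div, inv_pow, inv_mul_cancel_left₀ (by positivity)]
            exact hm.le
          calc 2 ^ (s + m) * min 1 ((a / 2 ^ (s + m)) ^ p)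
              ≤ 2 ^ (s + m) * (a / 2 ^ (s + m)) ^ (1 + (p - 1)) := by
                rw [add_sub_cancel]
                exact mul_le_mul_of_nonneg_left (min_le_right _ _) hN.le
            _ = 2 ^ (s + m) * (a / 2 ^ (s + m) * (a / 2 ^ (s + m)) ^ (p - 1)) := by
                rw [Real.rpow_add_of_nonneg hq zero_le_one hp1.le, Real.rpow_one]
            _ = a * (a / 2 ^ (s + m)) ^ (p - 1) := by
                rw [← mul_assoc, mul_div_cancel₀ _ hN.ne']
            _ ≤ a * ((1 / 2) ^ s) ^ (p - 1) :=
                mul_le_mul_of_nonneg_left (Real.rpow_le_rpow hq hq1 hp1.le) ha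
            _ = a * r ^ s := by
                rw [hr, ← Real.rpow_natCast, ← Real.rpow_natCast, ← Real.rpow_mul (by norm_num),
                  ← Real.rpow_mul (by norm_num), mul_comm (s : ℝ)]
      _ = ENNReal.ofReal (∑' s : ℕ, a * r ^ s) :=
          (ENNReal.ofReal_tsum_of_nonneg (fun _ => by positivity)
            ((summable_geometric_of_lt_one hr0.le (by linarith)).mul_left a)).symm
      _ ≤ _ := by
          refine ENNReal.ofReal_le_ofReal ?_
          rw [tsum_mul_left, tsum_geometric_of_lt_one hr0.le (by linarith), mul_comm]
          refine mul_le_mul_of_nonneg_right ?_ ha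
          rw [← inv_div]
          exact inv_anti₀ (by positivity) (by linarith)
  refine (add_le_add h1 h2).trans ?_
  rw [← ENNReal.ofReal_add (by positivity) (by positivity)]
  refine ENNReal.ofReal_le_ofReal ?_
  rw [← add_mul]
  refine mul_le_mul_of_nonneg_right ?_ ha
  -- The head's constant 2 is absorbed by `1 / (p - 1)`, since `p ≤ 3 / 2`.
  rw [show (3 : ℝ) / (p - 1) = 1 / (p - 1) + 2 / (p - 1) by ring]
  refine add_le_add ?_ le_rfl
  rw [le_div_iff₀ hp1]
  linarith

/-! ### Counting along orbits and transference -/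

section BilinearTail

variable {X : Type*} {T : X → X} {F G : X → ℝ≥0} {κ p : ℝ}

/-- Points `x` with `F (T ^ n x) G (T ^ (2 n) x) > n`, all of whose forward averages of `F ^ p`
are at most `κ`. -/
def goodTailSet (T : X → X) (F G : X → ℝ≥0) (κ p : ℝ) (n : ℕ) : Set X :=
  {x | (∀ k : ℕ, birkhoffSum T (fun y => ((F y ^ p : ℝ≥0) : ℝ)) k x ≤ κ * k) ∧
    (n : ℝ) < F (T^[n] x) * G (T^[2 * n] x)}

open Classical in
-- With the endpoint `T^[m] x` fixed, the factor `G` no longer depends on `n`, and the values of `F`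
-- sit at times `m - n`. The average bound at a single start `m - 2 * n₀` controls them all, because
-- `n < 2 * N ≤ 2 * n₀`.
lemma card_goodTailSet_le (hκ : 1 ≤ κ) (hp : 1 ≤ p) {N : ℕ} (hN : 0 < N) (m : ℕ) (x : X) :
    (((Finset.Ico N (2 * N)).filter
      fun n => 2 * n ≤ m ∧ T^[m - 2 * n] x ∈ goodTailSet T F G κ p n).card : ℝ) ≤
      N * min 1 ((4 * κ * G (T^[m] x) / N) ^ p) := by
  set P := (Finset.Ico N (2 * N)).filter
      fun n => 2 * n ≤ m ∧ T^[m - 2 * n] x ∈ goodTailSet T F G κ p n with hP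
  have hN' : (0 : ℝ) < N := by exact_mod_cast hN
  rw [mul_min_of_nonneg _ _ hN'.le, mul_one]
  refine le_min ?_ ?_
  · have := Finset.card_filter_le (Finset.Ico N (2 * N))
      fun n => 2 * n ≤ m ∧ T^[m - 2 * n] x ∈ goodTailSet T F G κ p n
    rw [Nat.card_Ico, show 2 * N - N = N by omega] at this
    exact_mod_cast this
  rcases P.eq_empty_or_nonempty with h0 | ⟨n₀, hn₀⟩
  · rw [h0, Finset.card_empty, Nat.cast_zero]
    positivity
  have hmem {n : ℕ} (hn : n ∈ P) : (N ≤ n ∧ n < 2 * N) ∧ 2 * n ≤ m ∧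
      T^[m - 2 * n] x ∈ goodTailSet T F G κ p n := by simpa [hP] using hn
  obtain ⟨⟨hn₀N, hn₀N'⟩, hn₀m, hn₀x⟩ := hmem hn₀
  set y := T^[m - 2 * n₀] x with hy
  set γ : ℝ := (G (T^[m] x) : ℝ) with hγ
  have hbig {n : ℕ} (hn : n ∈ P) : (N : ℝ) < F (T^[2 * n₀ - n] y) * γ := by
    obtain ⟨⟨hnN, hnN'⟩, hnm, -, hnx⟩ := hmem hn
    rw [← Function.iterate_add_apply, ← Function.iterate_add_apply] at hnx
    rw [hy, ← Function.iterate_add_apply]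
    rw [show n + (m - 2 * n) = m - n by omega, show 2 * n + (m - 2 * n) = m by omega] at hnx
    rw [show 2 * n₀ - n + (m - 2 * n₀) = m - n by omega]
    exact lt_of_le_of_lt (by exact_mod_cast hnN) hnx
  have hγ0 : 0 < γ := by
    refine (show 0 ≤ γ from NNReal.coe_nonneg _).lt_of_ne fun h => ?_
    have := hbig hn₀
    rw [← h, mul_zero] at this
    exact this.not_ge hN'.le
  have hsum : (P.card : ℝ) * (N / γ) ^ p ≤ 4 * κ * N := by
    calc (P.card : ℝ) * (N / γ) ^ p = ∑ n ∈ P, (N / γ) ^ p := by simp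
      _ ≤ ∑ n ∈ P, ((F (T^[2 * n₀ - n] y) ^ p : ℝ≥0) : ℝ) := by
          refine Finset.sum_le_sum fun n hn => ?_
          rw [NNReal.coe_rpow]
          refine Real.rpow_le_rpow (by positivity) ?_ (by linarith)
          rw [div_le_iff₀ hγ0]
          exact (hbig hn).le
      _ = ∑ k ∈ P.image (fun n => 2 * n₀ - n), ((F (T^[k] y) ^ p : ℝ≥0) : ℝ) := by
          refine (Finset.sum_image (f := fun k => ((F (T^[k] y) ^ p : ℝ≥0) : ℝ))
            fun a ha b hb hab => ?_).symm
          have ha' := (hmem ha).1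
          have hb' := (hmem hb).1
          omega
      _ ≤ ∑ k ∈ Finset.range (2 * n₀), ((F (T^[k] y) ^ p : ℝ≥0) : ℝ) := by
          refine Finset.sum_le_sum_of_subset_of_nonneg ?_ fun _ _ _ => NNReal.coe_nonneg _
          intro k hk
          obtain ⟨n, hn, rfl⟩ := Finset.mem_image.1 hk
          have := (hmem hn).1
          rw [Finset.mem_range]
          omega
      _ ≤ κ * (2 * n₀ : ℕ) := hn₀x.1 _
      _ ≤ 4 * κ * N := by
          have : (n₀ : ℝ) ≤ 2 * N := by exact_mod_cast hn₀N'.le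
          push_cast
          nlinarith
  have hpos : (0 : ℝ) < (N / γ) ^ p := by positivity
  rw [← le_div_iff₀ hpos] at hsum
  refine hsum.trans ?_
  rw [show 4 * κ * γ / N = 4 * κ * (γ / N) by ring,
    Real.mul_rpow (by positivity) (by positivity), div_eq_mul_inv,
    ← Real.inv_rpow (by positivity), inv_div, mul_comm (4 * κ), mul_assoc]
  refine mul_le_mul_of_nonneg_left (mul_le_mul_of_nonneg_right ?_ (by positivity)) hN'.le
  -- `4κ ≤ (4κ)^p` moves the constant inside the power.
  exact Real.self_le_rpow_of_one_le (by linarith) hp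

open Classical in
-- Regroup the pairs `(n, i)` by endpoint time `m = i + 2 * n`, which is below `N + 4 * N`.
lemma sum_indicator_goodTailSet_le (hκ : 1 ≤ κ) (hp : 1 ≤ p) {N : ℕ} (hN : 0 < N) (x : X) :
    ∑ n ∈ Finset.Ico N (2 * N), ∑ i ∈ Finset.range N,
      (goodTailSet T F G κ p n).indicator (1 : X → ℝ≥0∞) (T^[i] x) ≤
    ∑ m ∈ Finset.range (5 * N),
      ENNReal.ofReal (N * min 1 ((4 * κ * G (T^[m] x) / N) ^ p)) := by
  have hshift : ∀ n ∈ Finset.Ico N (2 * N), ∑ i ∈ Finset.range N,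
      (goodTailSet T F G κ p n).indicator (1 : X → ℝ≥0∞) (T^[i] x) ≤
      ∑ m ∈ Finset.range (5 * N),
        if 2 * n ≤ m ∧ T^[m - 2 * n] x ∈ goodTailSet T F G κ p n then 1 else 0 := by
    intro n hn
    rw [Finset.mem_Ico] at hn
    set ψ : ℕ → ℝ≥0∞ := fun m =>
      if 2 * n ≤ m ∧ T^[m - 2 * n] x ∈ goodTailSet T F G κ p n then 1 else 0 with hψ
    calc ∑ i ∈ Finset.range N, (goodTailSet T F G κ p n).indicator (1 : X → ℝ≥0∞) (T^[i] x)
        = ∑ i ∈ Finset.Ico 0 N, ψ (i + 2 * n) := by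
          rw [Finset.range_eq_Ico]
          refine Finset.sum_congr rfl fun i _ => ?_
          simp [hψ, Set.indicator_apply]
      _ = ∑ m ∈ Finset.Ico (0 + 2 * n) (N + 2 * n), ψ m := Finset.sum_Ico_add' _ _ _ _
      _ ≤ _ := by
          refine Finset.sum_le_sum_of_subset fun m hm => ?_
          rw [Finset.mem_Ico] at hm
          rw [Finset.mem_range]
          omega
  refine (Finset.sum_le_sum hshift).trans ?_
  rw [Finset.sum_comm]
  refine Finset.sum_le_sum fun m _ => ?_
  rw [← Finset.sum_filter, Finset.sum_const, nsmul_one, ← ENNReal.ofReal_natCast]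
  exact ENNReal.ofReal_le_ofReal (card_goodTailSet_le hκ hp hN m x)

variable [MeasurableSpace X] {μ : Measure X}

lemma measurableSet_goodTailSet (hT : Measurable T) (hF : Measurable F) (hG : Measurable G)
    (n : ℕ) : MeasurableSet (goodTailSet T F G κ p n) := by
  rw [goodTailSet, Set.ofPred_and, Set.ofPred_forall]
  refine MeasurableSet.inter ?_ ?_
  · refine MeasurableSet.iInter fun k => measurableSet_le ?_ measurable_const
    exact Finset.measurable_sum _ fun i _ =>
      ((hF.pow_const p).coe_nnreal_real).comp (hT.iterate i)
  · exact measurableSet_lt measurable_const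
      ((hF.comp (hT.iterate n)).coe_nnreal_real.mul (hG.comp (hT.iterate _)).coe_nnreal_real)

lemma sum_measure_goodTailSet_le (hT : MeasurePreserving T μ μ) (hF : Measurable F)
    (hG : Measurable G) (hκ : 1 ≤ κ) (hp : 1 ≤ p) {N : ℕ} (hN : 0 < N) :
    ∑ n ∈ Finset.Ico N (2 * N), μ (goodTailSet T F G κ p n) ≤
      5 * ∫⁻ x, ENNReal.ofReal (N * min 1 ((4 * κ * G x / N) ^ p)) ∂μ := by
  have hB (n : ℕ) : MeasurableSet (goodTailSet T F G κ p n) :=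
    measurableSet_goodTailSet hT.measurable hF hG n
  set φ : X → ℝ≥0∞ := fun x => ENNReal.ofReal (N * min 1 ((4 * κ * G x / N) ^ p)) with hφ
  have hφm : Measurable φ := by
    have := hG.coe_nnreal_real
    fun_prop
  have hind (n i : ℕ) :
      ∫⁻ x, (goodTailSet T F G κ p n).indicator (1 : X → ℝ≥0∞) (T^[i] x) ∂μ =
        μ (goodTailSet T F G κ p n) := by
    rw [(hT.iterate i).lintegral_comp (measurable_one.indicator (hB n)),
      lintegral_indicator_one (hB n)]
  have hmeas (n i : ℕ) :
      Measurable fun x => (goodTailSet T F G κ p n).indicator (1 : X → ℝ≥0∞) (T^[i] x) :=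
    (measurable_one.indicator (hB n)).comp (hT.measurable.iterate i)
  -- Averaging over `N` starting times: invariance produces a factor `N` on both sides, which
  -- cancels.
  have key : (N : ℝ≥0∞) * ∑ n ∈ Finset.Ico N (2 * N), μ (goodTailSet T F G κ p n) ≤
      N * (5 * ∫⁻ x, φ x ∂μ) := by
    calc (N : ℝ≥0∞) * ∑ n ∈ Finset.Ico N (2 * N), μ (goodTailSet T F G κ p n)
        = ∫⁻ x, ∑ n ∈ Finset.Ico N (2 * N), ∑ i ∈ Finset.range N,
            (goodTailSet T F G κ p n).indicator (1 : X → ℝ≥0∞) (T^[i] x) ∂μ := by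
          rw [lintegral_finsetSum _ fun n _ => Finset.measurable_fun_sum _ fun i _ => hmeas n i,
            Finset.mul_sum]
          refine Finset.sum_congr rfl fun n _ => ?_
          rw [lintegral_finsetSum _ fun i _ => hmeas n i]
          simp [hind]
      _ ≤ ∫⁻ x, ∑ m ∈ Finset.range (5 * N), φ (T^[m] x) ∂μ :=
          lintegral_mono fun x => sum_indicator_goodTailSet_le hκ hp hN x
      _ = N * (5 * ∫⁻ x, φ x ∂μ) := by
          have hφT (m : ℕ) : Measurable fun x => φ (T^[m] x) :=
            hφm.comp (hT.measurable.iterate m)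
          rw [lintegral_finsetSum _ fun m _ => hφT m]
          simp_rw [(hT.iterate _).lintegral_comp hφm]
          simp only [Finset.sum_const, Finset.card_range, nsmul_eq_mul]
          push_cast
          ring
  exact (ENNReal.mul_le_mul_iff_right (by exact_mod_cast hN.ne') (ENNReal.natCast_ne_top N)).1 key

end BilinearTail

/-! ### Weak type bound for the tail maximal function -/

section BilinearTailMaximal

variable {X : Type*} [MeasurableSpace X] {T : X → X} {μ : Measure X} {F G : X → ℝ≥0} {κ p : ℝ}

/-- Exceptional set plus dyadic blocks; `60 = 5 · 3 · 4` combines the transference, dyadic-sum and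
counting constants. -/
lemma measure_tail_le_add [IsProbabilityMeasure μ] (hT : MeasurePreserving T μ μ)
    (hF : Measurable F) (hG : Measurable G) (hp : 1 < p) (hp2 : p ≤ 3 / 2)
    (hFp : ∫⁻ x, (F x : ℝ≥0∞) ^ p ∂μ ≤ 1) (hκ : 1 ≤ κ) :
    μ {x | ∃ n : ℕ, 1 ≤ n ∧ (n : ℝ) < F (T^[n] x) * G (T^[2 * n] x)} ≤
      (ENNReal.ofReal κ)⁻¹ + ENNReal.ofReal (60 / (p - 1) * κ) * ∫⁻ x, G x ∂μ := by
  have hp1 : 0 < p - 1 := sub_pos.2 hp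
  set h : X → ℝ≥0 := fun y => F y ^ p with hh
  set E : Set X := {x | ∃ n : ℕ, κ * n < birkhoffSum T (fun y => (h y : ℝ)) n x} with hE
  have hh1 : ∫⁻ x, h x ∂μ ≤ 1 := by
    simpa [hh, ENNReal.coe_rpow_of_nonneg _ (zero_le_one.trans hp.le)] using hFp
  have hEle : μ E ≤ (ENNReal.ofReal κ)⁻¹ := by
    rw [ENNReal.le_inv_iff_mul_le, mul_comm]
    exact (mul_measure_lt_birkhoffSum_le hT (hF.pow_const p)
      (hh1.trans_lt ENNReal.one_lt_top).ne κ).trans hh1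
  have hsub : {x | ∃ n : ℕ, 1 ≤ n ∧ (n : ℝ) < F (T^[n] x) * G (T^[2 * n] x)} ⊆
      E ∪ ⋃ s : ℕ, ⋃ n ∈ Finset.Ico (2 ^ s) (2 * 2 ^ s), goodTailSet T F G κ p n := by
    rintro x ⟨n, hn1, hn⟩
    by_cases hx : x ∈ E
    · exact Or.inl hx
    · refine Or.inr (Set.mem_iUnion.2 ⟨Nat.log 2 n, Set.mem_iUnion₂.2 ⟨n, ?_, ?_, hn⟩⟩)
      · rw [Finset.mem_Ico, ← pow_succ']
        exact ⟨Nat.pow_log_le_self 2 (by omega), Nat.lt_pow_succ_log_self (by norm_num) n⟩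
      · exact fun k => not_lt.1 fun hk => hx ⟨k, hk⟩
  refine (measure_mono hsub).trans ((measure_union_le _ _).trans (add_le_add hEle ?_))
  have hm (s : ℕ) : Measurable fun x =>
      ENNReal.ofReal (2 ^ s * min 1 ((4 * κ * G x / 2 ^ s) ^ p)) := by
    have := hG.coe_nnreal_real
    fun_prop
  calc μ (⋃ s : ℕ, ⋃ n ∈ Finset.Ico (2 ^ s) (2 * 2 ^ s), goodTailSet T F G κ p n)
      ≤ ∑' s : ℕ, μ (⋃ n ∈ Finset.Ico (2 ^ s) (2 * 2 ^ s), goodTailSet T F G κ p n) :=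
        measure_iUnion_le _
    _ ≤ ∑' s : ℕ, 5 * ∫⁻ x, ENNReal.ofReal (2 ^ s * min 1 ((4 * κ * G x / 2 ^ s) ^ p)) ∂μ := by
        refine ENNReal.tsum_le_tsum fun s => (measure_biUnion_finset_le _ _).trans ?_
        simpa using sum_measure_goodTailSet_le hT hF hG hκ hp.le (N := 2 ^ s) (by positivity)
    _ = 5 * ∫⁻ x, ∑' s : ℕ, ENNReal.ofReal (2 ^ s * min 1 ((4 * κ * G x / 2 ^ s) ^ p)) ∂μ := by
        rw [ENNReal.tsum_mul_left, lintegral_tsum fun s => (hm s).aemeasurable]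
    _ ≤ 5 * ∫⁻ x, ENNReal.ofReal (3 / (p - 1) * (4 * κ)) * G x ∂μ := by
        refine mul_le_mul_right (lintegral_mono fun x => ?_) _
        refine (tsum_two_pow_mul_min_one_rpow_le hp hp2 (by positivity)).trans_eq ?_
        rw [← mul_assoc, ENNReal.ofReal_mul (by positivity), ENNReal.ofReal_coe_nnreal]
    _ = ENNReal.ofReal (60 / (p - 1) * κ) * ∫⁻ x, G x ∂μ := by
        rw [lintegral_const_mul _ hG.coe_nnreal_ennreal, ← mul_assoc,
          show (5 : ℝ≥0∞) = ENNReal.ofReal 5 by simp, ← ENNReal.ofReal_mul (by norm_num)]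
        congr 2
        ring

lemma measure_tail_eq_zero (hT : MeasurePreserving T μ μ) {c : ℝ} (hc : 0 ≤ c)
    (h : F =ᵐ[μ] 0 ∨ G =ᵐ[μ] 0) :
    μ {x | ∃ n : ℕ, 1 ≤ n ∧ c * n < F (T^[n] x) * G (T^[2 * n] x)} = 0 := by
  have h0 : ∀ᵐ x ∂μ, ∀ n : ℕ, (F (T^[n] x) : ℝ) * G (T^[2 * n] x) = 0 := by
    refine ae_all_iff.2 fun n => ?_
    rcases h with h | h
    · filter_upwards [(hT.iterate n).quasiMeasurePreserving.ae h] with x hx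
      simp [hx]
    · filter_upwards [(hT.iterate (2 * n)).quasiMeasurePreserving.ae h] with x hx
      simp [hx]
  refine measure_mono_null (fun x => ?_) (ae_iff.1 h0)
  rintro ⟨n, -, hn⟩ hx
  rw [hx n] at hn
  exact hn.not_ge (by positivity)

lemma measure_tail_le_of_normalized [IsProbabilityMeasure μ] (hT : MeasurePreserving T μ μ)
    (hF : Measurable F) (hG : Measurable G) (hp : 1 < p) (hp2 : p ≤ 3 / 2)
    (hFp : ∫⁻ x, (F x : ℝ≥0∞) ^ p ∂μ ≤ 1) :
    μ {x | ∃ n : ℕ, 1 ≤ n ∧ (n : ℝ) < F (T^[n] x) * G (T^[2 * n] x)} ≤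
      ENNReal.ofReal (61 / (p - 1)) * (∫⁻ x, G x ∂μ) ^ (1 / 2 : ℝ) := by
  have hp1 : 0 < p - 1 := sub_pos.2 hp
  have hC : 1 ≤ 1 / (p - 1) := by rw [le_div_iff₀ hp1]; linarith
  rcases eq_or_ne (∫⁻ x, G x ∂μ) 0 with h0 | h0
  · rw [lintegral_eq_zero_iff hG.coe_nnreal_ennreal] at h0
    have hG0 : G =ᵐ[μ] 0 := h0.mono fun x hx => by simpa using hx
    have := measure_tail_eq_zero hT zero_le_one (Or.inr hG0) (F := F)
    simp only [one_mul] at this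
    rw [this]
    exact zero_le
  -- The balancing `κ` is at least 1 only when `∫ G ≤ 1`; otherwise the bound exceeds 1 and is
  -- trivial.
  rcases le_or_gt 1 (∫⁻ x, G x ∂μ) with h1 | h1
  · refine prob_le_one.trans ?_
    rw [← one_mul (1 : ℝ≥0∞)]
    refine mul_le_mul' ?_ (ENNReal.one_le_rpow h1 (by norm_num))
    rw [ENNReal.one_le_ofReal]
    calc (1 : ℝ) ≤ 1 / (p - 1) := hC
      _ ≤ 61 / (p - 1) := by gcongr; norm_num
  · obtain ⟨a, ha⟩ : ∃ a : ℝ≥0, (a : ℝ≥0∞) = ∫⁻ x, G x ∂μ :=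
      ⟨_, ENNReal.coe_toNNReal (h1.trans ENNReal.one_lt_top).ne⟩
    rw [← ha] at h0 h1
    have ha0 : 0 < (a : ℝ) := by
      have : a ≠ 0 := by exact_mod_cast h0
      positivity
    have ha1 : (a : ℝ) ≤ 1 := by exact_mod_cast h1.le
    set r : ℝ := (a : ℝ) ^ (1 / 2 : ℝ) with hr
    have hr0 : 0 < r := by positivity
    have hr1 : r ≤ 1 := Real.rpow_le_one ha0.le ha1 (by norm_num)
    have hrr : r * r = a := by
      rw [hr, ← Real.rpow_add ha0]
      norm_num
    refine (measure_tail_le_add hT hF hG hp hp2 hFp (κ := r⁻¹) ((one_le_inv₀ hr0).2 hr1)).trans ?_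
    rw [← ha, ← ENNReal.ofReal_inv_of_pos (inv_pos.2 hr0), inv_inv, ← ENNReal.ofReal_coe_nnreal,
      ENNReal.ofReal_rpow_of_pos ha0, ← hr, ← ENNReal.ofReal_mul (by positivity),
      ← ENNReal.ofReal_mul (by positivity), ← ENNReal.ofReal_add hr0.le (by positivity)]
    refine ENNReal.ofReal_le_ofReal ?_
    rw [← hrr, mul_assoc, inv_mul_cancel_left₀ hr0.ne',
      show (61 : ℝ) / (p - 1) = 1 / (p - 1) + 60 / (p - 1) by ring, add_mul]
    exact add_le_add (le_mul_of_one_le_left hr0.le hC) le_rfl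

/-- Homogeneity: with `M = ‖F‖_p`, replace `F` by `F / M` and `G` by `M G / λ`. The degenerate norms
0 and `∞` are separated out first. -/
lemma measure_tail_le [IsProbabilityMeasure μ] (hT : MeasurePreserving T μ μ)
    (hF : Measurable F) (hG : Measurable G) (hp : 1 < p) (hp2 : p ≤ 3 / 2)
    {lam : ℝ} (hlam : 0 < lam) :
    μ {x | ∃ n : ℕ, 1 ≤ n ∧ lam * n < F (T^[n] x) * G (T^[2 * n] x)} ≤
      ENNReal.ofReal (61 / (p - 1)) *
        ((∫⁻ x, (F x : ℝ≥0∞) ^ p ∂μ) ^ (1 / p) * (∫⁻ x, G x ∂μ) / ENNReal.ofReal lam)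
          ^ (1 / 2 : ℝ) := by
  have hp0 : 0 < p := by linarith
  have hp1 : 0 < p - 1 := sub_pos.2 hp
  by_cases hz : F =ᵐ[μ] 0 ∨ G =ᵐ[μ] 0
  · rw [measure_tail_eq_zero hT hlam.le hz]
    exact zero_le
  push Not at hz
  have hI0 : ∫⁻ x, (F x : ℝ≥0∞) ^ p ∂μ ≠ 0 := by
    rw [Ne, lintegral_eq_zero_iff (hF.coe_nnreal_ennreal.pow_const p)]
    exact fun h => hz.1 (h.mono fun x hx => by simpa [hp0, hp0.le, hp0.not_gt] using hx)
  have hJ0 : ∫⁻ x, G x ∂μ ≠ 0 := by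
    rw [Ne, lintegral_eq_zero_iff hG.coe_nnreal_ennreal]
    exact fun h => hz.2 (h.mono fun x hx => by simpa using hx)
  rcases eq_or_ne (∫⁻ x, (F x : ℝ≥0∞) ^ p ∂μ) ∞ with hI | hI
  · rw [hI, ENNReal.top_rpow_of_pos (by positivity), ENNReal.top_mul hJ0,
      ENNReal.top_div_of_ne_top ENNReal.ofReal_ne_top, ENNReal.top_rpow_of_pos (by norm_num),
      ENNReal.mul_top (ENNReal.ofReal_pos.2 (by positivity)).ne']
    exact le_top
  obtain ⟨M, hM⟩ : ∃ M : ℝ≥0, (M : ℝ≥0∞) = (∫⁻ x, (F x : ℝ≥0∞) ^ p ∂μ) ^ (1 / p) :=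
    ⟨_, ENNReal.coe_toNNReal (ENNReal.rpow_ne_top_of_nonneg (one_div_pos.2 hp0).le hI)⟩
  have hM0 : 0 < M := by
    rw [pos_iff_ne_zero]
    rintro rfl
    rw [ENNReal.coe_zero, eq_comm, ENNReal.rpow_eq_zero_iff_of_pos (by positivity)] at hM
    exact hI0 hM
  have hMp : (M : ℝ≥0∞) ^ p = ∫⁻ x, (F x : ℝ≥0∞) ^ p ∂μ := by
    rw [hM, ← ENNReal.rpow_mul, one_div_mul_cancel hp0.ne', ENNReal.rpow_one]
  set l : ℝ≥0 := ⟨lam, hlam.le⟩ with hl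
  have hl0 : 0 < l := hlam
  have hllam : ENNReal.ofReal lam = l := by
    rw [show lam = (l : ℝ) from rfl, ENNReal.ofReal_coe_nnreal]
  have hFM : ∫⁻ x, ((M⁻¹ * F x : ℝ≥0) : ℝ≥0∞) ^ p ∂μ ≤ 1 := by
    simp_rw [ENNReal.coe_mul, ENNReal.mul_rpow_of_nonneg _ _ hp0.le]
    rw [lintegral_const_mul _ (hF.coe_nnreal_ennreal.pow_const p), ← hMp,
      ← ENNReal.mul_rpow_of_nonneg _ _ hp0.le, ← ENNReal.coe_mul, inv_mul_cancel₀ hM0.ne']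
    simp
  have hGM : ∫⁻ x, ((M * l⁻¹ * G x : ℝ≥0) : ℝ≥0∞) ∂μ =
      (∫⁻ x, (F x : ℝ≥0∞) ^ p ∂μ) ^ (1 / p) * (∫⁻ x, G x ∂μ) / ENNReal.ofReal lam := by
    simp_rw [ENNReal.coe_mul]
    rw [lintegral_const_mul _ hG.coe_nnreal_ennreal, ← hM, hllam, ENNReal.coe_inv hl0.ne',
      div_eq_mul_inv]
    ring
  have key := measure_tail_le_of_normalized hT (hF.const_mul M⁻¹) (hG.const_mul (M * l⁻¹))
    hp hp2 hFM
  rw [hGM] at key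
  refine (measure_mono ?_).trans key
  rintro x ⟨n, hn1, hn⟩
  refine ⟨n, hn1, ?_⟩
  have hM0' : (M : ℝ) ≠ 0 := by exact_mod_cast hM0.ne'
  have hll : (l : ℝ) = lam := rfl
  push_cast
  rw [hll]
  calc (n : ℝ) < F (T^[n] x) * G (T^[2 * n] x) / lam := by
        rw [lt_div_iff₀ hlam, mul_comm]
        exact hn
    _ = _ := by field_simp

lemma lt_tailMaximal_iff {X : Type*} {T : X → X} {f g : X → ℝ} {x : X} {c : ℝ} :
    (c : EReal) < tailMaximal T f g x ↔
      ∃ n : ℕ, 1 ≤ n ∧ c * n < f (T^[n] x) * g (T^[2 * n] x) := by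
  simp only [tailMaximal, lt_iSup_iff, EReal.coe_lt_coe_iff, exists_prop]
  refine exists_congr fun n => and_congr_right fun hn => lt_div_iff₀ ?_
  exact_mod_cast hn

lemma exists_measurable_nnreal_ae_eq {f : X → ℝ} (hf : AEStronglyMeasurable f μ)
    (h0 : ∀ᵐ x ∂μ, 0 ≤ f x) : ∃ F : X → ℝ≥0, Measurable F ∧ f =ᵐ[μ] fun x => (F x : ℝ) := by
  refine ⟨fun x => (hf.mk f x).toNNReal, hf.stronglyMeasurable_mk.measurable.real_toNNReal, ?_⟩
  filter_upwards [hf.ae_eq_mk, h0] with x hx hx0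
  rw [← hx, Real.coe_toNNReal _ hx0]

/-- The weak type bound for the tail maximal function when `1 < p ≤ 3 / 2`. -/
lemma measure_lt_tailMaximal_le [IsProbabilityMeasure μ] (hT : MeasurePreserving T μ μ)
    {f g : X → ℝ} (hf : AEStronglyMeasurable f μ) (hg : AEStronglyMeasurable g μ)
    (hf0 : ∀ᵐ x ∂μ, 0 ≤ f x) (hg0 : ∀ᵐ x ∂μ, 0 ≤ g x) (hp : 1 < p) (hp2 : p ≤ 3 / 2)
    {lam : ℝ} (hlam : 0 < lam) :
    μ {x | (lam : EReal) < tailMaximal T f g x} ≤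
      ENNReal.ofReal (61 / (p - 1)) *
        (eLpNorm f (ENNReal.ofReal p) μ * eLpNorm g 1 μ / ENNReal.ofReal lam) ^ (1 / 2 : ℝ) := by
  have hp0 : 0 < p := by linarith
  obtain ⟨F, hF, hfF⟩ := exists_measurable_nnreal_ae_eq hf hf0
  obtain ⟨G, hG, hgG⟩ := exists_measurable_nnreal_ae_eq hg hg0
  have hnf : eLpNorm f (ENNReal.ofReal p) μ = (∫⁻ x, (F x : ℝ≥0∞) ^ p ∂μ) ^ (1 / p) := by
    rw [eLpNorm_congr_ae hfF, eLpNorm_eq_lintegral_rpow_enorm_toReal (by simpa using hp0)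
      ENNReal.ofReal_ne_top, ENNReal.toReal_ofReal hp0.le]
    simp [enorm_eq_nnnorm]
  have hng : eLpNorm g 1 μ = ∫⁻ x, G x ∂μ := by
    rw [eLpNorm_congr_ae hgG, eLpNorm_one_eq_lintegral_enorm]
    simp [enorm_eq_nnnorm]
  rw [hnf, hng]
  -- Almost everywhere the representatives agree with `f` and `g` along the whole forward orbit.
  refine le_trans (measure_mono_ae ?_) (measure_tail_le hT hF hG hp hp2 hlam)
  have hf' := ae_all_iff.2 fun n : ℕ => (hT.iterate n).quasiMeasurePreserving.ae hfF
  have hg' := ae_all_iff.2 fun n : ℕ => (hT.iterate n).quasiMeasurePreserving.ae hgG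
  filter_upwards [hf', hg'] with x hx hx'
  intro h
  obtain ⟨n, hn1, hn⟩ := lt_tailMaximal_iff.1 (show (lam : EReal) < tailMaximal T f g x from h)
  rw [hx, hx'] at hn
  exact ⟨n, hn1, hn⟩

end BilinearTailMaximal

theorem theorem1 :
    ∃ C : ℝ → ℝ≥0,
      (∀ p : ℝ, 1 < p →
        ∀ (X : Type u) [MeasurableSpace X] (μ : Measure X) [IsProbabilityMeasure μ] (T : X → X),
          IsNonatomic μ → Ergodic T μ →
          ∀ f g : X → ℝ, AEStronglyMeasurable f μ → AEStronglyMeasurable g μ →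
            (∀ᵐ x ∂μ, 0 ≤ f x) → (∀ᵐ x ∂μ, 0 ≤ g x) →
            ∀ lam : ℝ, 0 < lam →
              μ {x | (lam : EReal) < tailMaximal T f g x} ≤
                (C p : ℝ≥0∞) *
                  (eLpNorm f (ENNReal.ofReal p) μ * eLpNorm g 1 μ / ENNReal.ofReal lam)
                    ^ (1 / 2 : ℝ)) ∧
      ∃ C' : ℝ, ∀ p : ℝ, 1 < p → p < 2 → (C p : ℝ) ≤ C' / (p - 1) := by
  -- Capping the exponent at `3 / 2` is harmless: on a probability space `L^p` norms increase with
  -- `p`. For `p < 2` it at most halves `p - 1`, whence `122 = 2 · 61`.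
  refine ⟨fun p => (61 / (min p (3 / 2) - 1)).toNNReal, ?_, 122, ?_⟩
  · intro p hp X _ μ _ T _ hT f g hf hg hf0 hg0 lam hlam
    have hq : 1 < min p (3 / 2) := lt_min hp (by norm_num)
    refine (measure_lt_tailMaximal_le hT.toMeasurePreserving hf hg hf0 hg0 hq
      (min_le_right _ _) hlam).trans ?_
    refine mul_le_mul_right (ENNReal.rpow_le_rpow ?_ (by norm_num)) _
    refine ENNReal.div_le_div_right (mul_le_mul_left ?_ _) _
    exact eLpNorm_le_eLpNorm_of_exponent_le (ENNReal.ofReal_le_ofReal (min_le_left _ _)) hf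
  · intro p hp hp2
    have hp1 : 0 < p - 1 := sub_pos.2 hp
    have hmin : (p - 1) / 2 ≤ min p (3 / 2) - 1 := by
      rw [le_sub_iff_add_le]
      exact le_min (by linarith) (by linarith)
    rw [Real.coe_toNNReal _ (div_nonneg (by norm_num) (le_trans (by positivity) hmin))]
    calc 61 / (min p (3 / 2) - 1) ≤ 61 / ((p - 1) / 2) := by gcongr
      _ = 122 / (p - 1) := by field_simp; norm_num
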